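/- **Definitions.** The number of bits of an integer is the length of its binary encoding, sign bit included. A *PA specification* is a formula $\forall\bar x\,\exists\bar y\colon\varphi(\bar x,\bar y)$ with input variables $\bar x=(x_1,\dots,x_k)$ and output variables $\bar y=(y_1,\dots,y_m)$ ranging over $\mathbb Z$. Here $\varphi$ is quantifier-free, built with $\wedge$ and $\vee$ from linear inequalities $\sum_i a_iz_i+b\ge 0$ and modulo constraints $\sum_i a_iz_i\equiv r \pmod M$ and $\sum_i a_iz_i\not\equiv r\pmod M$, where the $z_i$ are the variables in $\bar x,\bar y$ and $a_i,b,r,M\in\mathbb Z$ with $0\le r<M$. Its *size* is the number of nodes of the tree of $\varphi$, plus the number of variables, plus the number of bits of all constants in the leaves. A function $f\colon\mathbb Z^k\to\mathbb Z^m$ is a *Skolem function* for the specification if for every $\bar u\in\mathbb Z^k$ such that $\varphi(\bar u,\bar v)$ holds for some $\bar v\in\mathbb Z^m$, also $\varphi(\bar u,f(\bar u))$ holds. A *Presburger circuit* with $k$ inputs and $m$ outputs is an acyclic circuit over $\mathbb Z$ with $k$ input nodes and $m$ designated output nodes, whose gates compute integer affine functions $b+\sum_j a_jx_j$ (of any fan-in),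 the maximum $\max(x,y)$, the zero conditional $\mathsf E(x,y)$ (equal to $y$ if $x=0$ and to $0$ otherwise), or a division $\mathsf{div}_m(x)=\lfloor x/m\rfloor$ by a nonzero integer constant $m$. It computes a function $\mathbb Z^k\to\mathbb Z^m$. Its *size* is the number of its nodes, plus the number of its wires into gates, plus the number of bits of all constants occurring in its gates. **Theorem.** There is a family $(\mu_n)_{n\ge 0}$ of PA specifications, of size polynomial in $n$, such that every Presburger circuit that computes a Skolem function for $\mu_n$ has size $2^{\Omega(n)}$. That is, there are a polynomial $p$, a constant $c>0$ and an $n_0\in\mathbb N$ such that $\mu_n$ has size at most $p(n)$ for every $n\ge 0$, and for every $n\ge n_0$, every Presburger circuit computing any Skolem function for $\mu_n$ has size at least $2^{cn}$. -/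

import Mathlib

namespace PresburgerSynthesis

/-- Number of bits of the binary encoding of an integer (absolute value plus a sign bit). -/
def intBits (a : ℤ) : ℕ := Nat.size a.natAbs + 1

/-! ### Quantifier-free Presburger formulas and specifications -/

/-- Quantifier-free formulas of Presburger arithmetic in negation normal form, with variables
indexed by `V`. The leaves are linear inequalities `∑ v, a v * x v + b ≥ 0` and (possibly negated)
modulo constraints `∑ v, a v * x v ≡ r (mod M)` with `0 ≤ r < M`. -/
inductive QFFormula (V : Type) : Type
  | linGe (a : V → ℤ) (b : ℤ) : QFFormula V
  | modEq (a : V → ℤ) (r M : ℤ) (h : 0 ≤ r ∧ r < M) : QFFormula V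
  | notModEq (a : V → ℤ) (r M : ℤ) (h : 0 ≤ r ∧ r < M) : QFFormula V
  | and (φ ψ : QFFormula V) : QFFormula V
  | or (φ ψ : QFFormula V) : QFFormula V

namespace QFFormula

variable {V : Type} [Fintype V]

/-- Satisfaction of a formula by an integer assignment. -/
def Holds : QFFormula V → (V → ℤ) → Prop
  | linGe a b, x => 0 ≤ (∑ v, a v * x v) + b
  | modEq a r M _, x => (∑ v, a v * x v) ≡ r [ZMOD M]
  | notModEq a r M _, x => ¬ (∑ v, a v * x v) ≡ r [ZMOD M]
  | and φ ψ, x => φ.Holds x ∧ ψ.Holds x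
  | or φ ψ, x => φ.Holds x ∨ ψ.Holds x

/-- Number of nodes of the tree of the formula plus the number of bits of all the constants in
its leaves. -/
def treeSize : QFFormula V → ℕ
  | linGe a b => 1 + (∑ v, intBits (a v)) + intBits b
  | modEq a r M _ => 1 + (∑ v, intBits (a v)) + intBits r + intBits M
  | notModEq a r M _ => 1 + (∑ v, intBits (a v)) + intBits r + intBits M
  | and φ ψ => 1 + φ.treeSize + ψ.treeSize
  | or φ ψ => 1 + φ.treeSize + ψ.treeSize

/-- Size of a formula: nodes of the tree, number of variables, bits of the constants. -/
def size (φ : QFFormula V) : ℕ := φ.treeSize + Fintype.card V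

end QFFormula

/-- A specification `∀ x ∃ y, φ(x, y)`: a quantifier-free formula whose variables are partitioned
into input variables `x` (left summand) and output variables `y` (right summand). -/
structure Specification where
  inputs : ℕ
  outputs : ℕ
  formula : QFFormula (Fin inputs ⊕ Fin outputs)

namespace Specification

/-- The size of a specification is the size of its formula. -/
def size (μ : Specification) : ℕ := μ.formula.size

/-- The relation between input tuples and output tuples that is specified. -/
def Rel (μ : Specification) (x : Fin μ.inputs → ℤ) (y : Fin μ.outputs → ℤ) : Prop :=
  μ.formula.Holds (Sum.elim x y)

/-- `f` is a Skolem function for the outputs of `μ`: whenever some output tuple fits the input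
tuple `x`, the tuple `f x` does. -/
def IsSkolem (μ : Specification) (f : (Fin μ.inputs → ℤ) → (Fin μ.outputs → ℤ)) : Prop :=
  ∀ x, (∃ y, μ.Rel x y) → μ.Rel x (f x)

end Specification

/-! ### Presburger circuits -/

/-- A gate that reads some of `w` already computed values: an integer affine function
`b + ∑ aⱼ * xⱼ` (of arbitrary fan-in, given by the list of pairs of a coefficient and a source),
the binary maximum, the zero conditional `E(x, y)` (which is `y` if `x = 0`, and `0` otherwise), or
the rounded division `div_m(x) = ⌊x / m⌋` by a nonzero integer constant `m`. -/
inductive Gate (w : ℕ) : Type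
  | affine (b : ℤ) (l : List (ℤ × Fin w)) : Gate w
  | max (i j : Fin w) : Gate w
  | zeroCond (i j : Fin w) : Gate w
  | div (m : ℤ) (hm : m ≠ 0) (i : Fin w) : Gate w

namespace Gate

variable {w : ℕ}

/-- The value of a gate, given the values it may read. -/
def eval : Gate w → (Fin w → ℤ) → ℤ
  | affine b l, x => b + (l.map fun p => p.1 * x p.2).sum
  | max i j, x => Max.max (x i) (x j)
  | zeroCond i j, x => if x i = 0 then x j else 0
  | div m _ i, x => ⌊(x i : ℚ) / (m : ℚ)⌋

/-- Size contribution of a gate: one for the gate, one for each incoming wire, and the bits of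
its constants. -/
def size : Gate w → ℕ
  | affine b l => 1 + l.length + intBits b + (l.map fun p => intBits p.1).sum
  | max _ _ => 3
  | zeroCond _ _ => 3
  | div m _ _ => 2 + intBits m

end Gate

/-- A sequence of gates over `k` inputs, topologically sorted: every gate reads inputs or earlier
gates, each of which can be read by any number of later gates. `GateSeq k w` has `w` nodes, namely
the `k` inputs and `w - k` gates. -/
inductive GateSeq (k : ℕ) : ℕ → Type
  | inputs : GateSeq k k
  | snoc {w : ℕ} (s : GateSeq k w) (g : Gate w) : GateSeq k (w + 1)

namespace GateSeq

variable {k : ℕ}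

/-- The values of all the nodes on an input tuple. -/
def eval : {w : ℕ} → GateSeq k w → (Fin k → ℤ) → (Fin w → ℤ)
  | _, inputs, x => x
  | _, snoc s g, x => Fin.snoc (α := fun _ => ℤ) (s.eval x) (g.eval (s.eval x))

/-- One for each input node, and the sizes of the gates. -/
def size : {w : ℕ} → GateSeq k w → ℕ
  | _, inputs => k
  | _, snoc s g => s.size + g.size

end GateSeq

/-- A Presburger circuit with `k` inputs and `m` outputs: a directed acyclic graph of gates, with
`m` designated output nodes. -/
structure Circuit (k m : ℕ) where
  nodes : ℕ
  gates : GateSeq k nodes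
  out : Fin m → Fin nodes

namespace Circuit

variable {k m : ℕ}

/-- The function `ℤ^k → ℤ^m` computed by a circuit. -/
def eval (C : Circuit k m) (x : Fin k → ℤ) : Fin m → ℤ := fun j => C.gates.eval x (C.out j)

/-- The size of a circuit: its nodes, its wires, and the bits of the constants in its gates. -/
def size (C : Circuit k m) : ℕ := C.gates.size

end Circuit

end PresburgerSynthesis

/-!
The specification `nonDivisorSpec K` asks, given `x`, for a `K`-bit number `m` that does not divide
`x`. It can be written with polynomially many linear constraints, because the product of an
unbounded integer `q` with a `K`-bit number `m = ∑ 2 ^ i * bᵢ` is `∑ 2 ^ i * pᵢ`, where each `pᵢ` is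
`0` or `q` according to the bit `bᵢ`.

A circuit has little room for periodicity. Let `P` be the product of the constants by which it
divides, so that `|P| < 2 ^ size`. On the inputs `x = P * t` every node is an affine function of
`t` for all large `t` (`GateSeq.eventuallyAffine_eval`). The bits of the output take the values `0`
and `1` only, so they are eventually constant, and the circuit answers with one and the same number
`m`. For `t` a multiple of `m` that answer is wrong, unless `P * m` is divisible by all positive
`K`-bit numbers. In that case `P * m` is divisible by a central binomial coefficient
(`exists_not_dvd_of_lt_centralBinom`), which is doubly exponential in `K`; hence the size of the
circuit is exponential in `K`.
-/

namespace PresburgerSynthesis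

open Filter

/-! ### Formulas -/

namespace QFFormula

variable {V : Type}

/-- The linear equation `∑ v, a v * x v + b = 0`, as a conjunction of two inequalities. -/
def linEq (a : V → ℤ) (b : ℤ) : QFFormula V := and (linGe a b) (linGe (-a) (-b))

/-- The conjunction of `φ` and of all the formulas in a list. -/
def conj (φ : QFFormula V) (l : List (QFFormula V)) : QFFormula V := l.foldr and φ

variable [Fintype V]

theorem holds_linEq {a : V → ℤ} {b : ℤ} {x : V → ℤ} :
    (linEq a b).Holds x ↔ (∑ v, a v * x v) + b = 0 := by
  simp only [linEq, Holds, Pi.neg_apply, neg_mul, Finset.sum_neg_distrib]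
  omega

theorem holds_conj {φ : QFFormula V} {l : List (QFFormula V)} {x : V → ℤ} :
    (conj φ l).Holds x ↔ (∀ ψ ∈ l, ψ.Holds x) ∧ φ.Holds x := by
  induction l with
  | nil => simp [conj]
  | cons ψ l ih =>
    have h : (conj φ (ψ :: l)).Holds x ↔ ψ.Holds x ∧ (conj φ l).Holds x := Iff.rfl
    rw [h, ih, List.forall_mem_cons, and_assoc]

theorem treeSize_conj_le {φ : QFFormula V} {l : List (QFFormula V)} {S : ℕ}
    (h : ∀ ψ ∈ l, ψ.treeSize ≤ S) :
    (conj φ l).treeSize ≤ l.length * (1 + S) + φ.treeSize := by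
  induction l with
  | nil => simp [conj]
  | cons ψ l ih =>
    have e : (conj φ (ψ :: l)).treeSize = 1 + ψ.treeSize + (conj φ l).treeSize := rfl
    have h₁ := h ψ (by simp)
    have h₂ := ih fun χ hχ => h χ (by simp [hχ])
    rw [e, List.length_cons, add_mul]
    omega

end QFFormula

theorem intBits_le {a : ℤ} {K : ℕ} (h : |a| ≤ 2 ^ K) : intBits a ≤ K + 2 := by
  have h₁ : a.natAbs ≤ 2 ^ K := by
    zify
    exact h
  have h₂ : Nat.size a.natAbs ≤ K + 1 :=
    Nat.size_le.2 (h₁.trans_lt (Nat.pow_lt_pow_right (by norm_num) (Nat.lt_succ_self K)))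
  unfold intBits
  omega

namespace QFFormula

variable {V : Type} [Fintype V] {K : ℕ} {a : V → ℤ} {b : ℤ}

theorem treeSize_linGe_le (ha : ∀ v, |a v| ≤ 2 ^ K) (hb : |b| ≤ 2 ^ K) :
    (linGe a b).treeSize ≤ 1 + (Fintype.card V + 1) * (K + 2) := by
  have h₁ : ∑ v, intBits (a v) ≤ Fintype.card V * (K + 2) := by
    have := Finset.sum_le_card_nsmul Finset.univ (fun v => intBits (a v)) (K + 2)
      fun v _ => intBits_le (ha v)
    simpa using this
  have h₂ := intBits_le hb
  simp only [treeSize]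
  rw [add_mul]
  omega

theorem treeSize_linEq_le (ha : ∀ v, |a v| ≤ 2 ^ K) (hb : |b| ≤ 2 ^ K) :
    (linEq a b).treeSize ≤ 3 + 2 * ((Fintype.card V + 1) * (K + 2)) := by
  have h₁ := treeSize_linGe_le ha hb
  have h₂ : (linGe (-a) (-b)).treeSize ≤ _ :=
    treeSize_linGe_le (K := K) (fun v => by simpa using ha v) (by simpa using hb)
  simp only [linEq, treeSize] at *
  omega

end QFFormula

/-! ### The specification -/

section NonDivisor

open QFFormula

variable {K : ℕ}

/-- The output that holds the bit `bᵢ` of the number that is asked for. -/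
def bitVar (i : Fin K) : Fin (K + K + 1) := (Fin.castAdd K i).castSucc

/-- The output that holds the product `pᵢ` of the bit `bᵢ` with the quotient `q`. -/
def prodVar (i : Fin K) : Fin (K + K + 1) := (Fin.natAdd K i).castSucc

/-- The coefficients of the linear form `cx * x + ∑ i, cb i * bᵢ + ∑ i, cp i * pᵢ + cq * q`. -/
def coeffs (cx : ℤ) (cb cp : Fin K → ℤ) (cq : ℤ) : Fin 1 ⊕ Fin (K + K + 1) → ℤ :=
  Sum.elim (fun _ => cx) (Fin.snoc (α := fun _ => ℤ) (Fin.append cb cp) cq)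

theorem sum_coeffs_mul (cx : ℤ) (cb cp : Fin K → ℤ) (cq : ℤ) (x : Fin 1 → ℤ)
    (y : Fin (K + K + 1) → ℤ) :
    ∑ v, coeffs cx cb cp cq v * Sum.elim x y v =
      cx * x 0 + (∑ i, cb i * y (bitVar i) + ∑ i, cp i * y (prodVar i) +
        cq * y (Fin.last _)) := by
  simp only [coeffs, Fintype.sum_sum_type, Finset.univ_unique, Finset.sum_singleton,
    Sum.elim_inl, Sum.elim_inr, Fin.sum_univ_castSucc (n := K + K), Fin.sum_univ_add,
    Fin.snoc_castSucc, Fin.snoc_last, Fin.append_left, Fin.append_right, bitVar, prodVar]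
  rfl

theorem abs_coeffs_le {cx : ℤ} {cb cp : Fin K → ℤ} {cq B : ℤ} (hx : |cx| ≤ B)
    (hb : ∀ i, |cb i| ≤ B) (hp : ∀ i, |cp i| ≤ B) (hq : |cq| ≤ B)
    (v : Fin 1 ⊕ Fin (K + K + 1)) : |coeffs cx cb cp cq v| ≤ B := by
  rcases v with v | v
  · exact hx
  · refine Fin.lastCases ?_ (fun j => ?_) v
    · simpa [coeffs] using hq
    · refine Fin.addCases (fun i => ?_) (fun i => ?_) j
      · simpa only [coeffs, Sum.elim_inr, Fin.snoc_castSucc, Fin.append_left] using hb i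
      · simpa only [coeffs, Sum.elim_inr, Fin.snoc_castSucc, Fin.append_right] using hp i

/-- `bᵢ = 0` and `pᵢ = 0`, or `bᵢ = 1` and `pᵢ = q`. -/
def digitFormula (i : Fin K) : QFFormula (Fin 1 ⊕ Fin (K + K + 1)) :=
  or (and (linEq (coeffs 0 (Pi.single i 1) 0 0) 0) (linEq (coeffs 0 0 (Pi.single i 1) 0) 0))
    (and (linEq (coeffs 0 (Pi.single i 1) 0 0) (-1))
      (linEq (coeffs 0 0 (Pi.single i 1) (-1)) 0))

/-- `1 ≤ x - ∑ i, 2 ^ i * pᵢ ≤ (∑ i, 2 ^ i * bᵢ) - 1`. -/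
def remainderFormula (K : ℕ) : QFFormula (Fin 1 ⊕ Fin (K + K + 1)) :=
  and (linGe (coeffs 1 0 (fun i : Fin K => -2 ^ (i : ℕ)) 0) (-1))
    (linGe (coeffs (-1) (fun i : Fin K => 2 ^ (i : ℕ)) (fun i : Fin K => 2 ^ (i : ℕ)) 0) (-1))

/-- The specification that asks for (the bits of) a `K`-bit number `m` that does not divide the
input `x`, together with the quotient `q = ⌊x / m⌋` and its products with the bits of `m`. -/
def nonDivisorSpec (K : ℕ) : Specification where
  inputs := 1
  outputs := K + K + 1
  formula := conj (remainderFormula K) (List.ofFn digitFormula)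

theorem rel_nonDivisorSpec {x : Fin 1 → ℤ} {y : Fin (K + K + 1) → ℤ} :
    (nonDivisorSpec K).Rel x y ↔
      (∀ i, y (bitVar i) = 0 ∧ y (prodVar i) = 0 ∨
        y (bitVar i) = 1 ∧ y (prodVar i) = y (Fin.last _)) ∧
      1 ≤ x 0 - ∑ i : Fin K, 2 ^ (i : ℕ) * y (prodVar i) ∧
      x 0 - ∑ i : Fin K, 2 ^ (i : ℕ) * y (prodVar i) <
        ∑ i : Fin K, 2 ^ (i : ℕ) * y (bitVar i) := by
  unfold Specification.Rel nonDivisorSpec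
  simp only [holds_conj, List.forall_mem_ofFn_iff]
  refine and_congr (forall_congr' fun i => ?_) ?_
  · simp only [digitFormula, Holds, holds_linEq, sum_coeffs_mul, Pi.single_apply, Pi.zero_apply,
      ite_mul, zero_mul, one_mul, Finset.sum_ite_eq', Finset.mem_univ, if_true,
      Finset.sum_const_zero]
    omega
  · simp only [remainderFormula, Holds, sum_coeffs_mul, Pi.zero_apply, zero_mul,
      Finset.sum_const_zero, neg_mul, Finset.sum_neg_distrib]
    omega

theorem size_nonDivisorSpec_le (K : ℕ) :
    (nonDivisorSpec K).size ≤ K * (16 + 8 * ((2 * K + 3) * (K + 2))) +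
      (3 + 2 * ((2 * K + 3) * (K + 2))) + (2 * K + 2) := by
  have hcard : Fintype.card (Fin 1 ⊕ Fin (K + K + 1)) = 2 * K + 2 := by
    simp only [Fintype.card_sum, Fintype.card_fin]
    omega
  have h1 : (1 : ℤ) ≤ 2 ^ K := one_le_pow₀ (by norm_num)
  have h0 : |(0 : ℤ)| ≤ 2 ^ K := by simp
  have hone : |(1 : ℤ)| ≤ 2 ^ K := by simpa using h1
  have hneg : |(-1 : ℤ)| ≤ 2 ^ K := by simpa using h1
  have hsingle (i j : Fin K) : |(Pi.single i 1 : Fin K → ℤ) j| ≤ 2 ^ K := by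
    rw [Pi.single_apply]
    split_ifs
    exacts [hone, h0]
  have hzero (j : Fin K) : |(0 : Fin K → ℤ) j| ≤ 2 ^ K := h0
  have hpow (j : Fin K) : |(2 : ℤ) ^ (j : ℕ)| ≤ 2 ^ K := by
    rw [abs_of_nonneg (by positivity)]
    exact pow_le_pow_right₀ (by norm_num) j.2.le
  have hpow' (j : Fin K) : |-(2 : ℤ) ^ (j : ℕ)| ≤ 2 ^ K := by
    rw [abs_neg]
    exact hpow j
  have hdigit : ∀ ψ ∈ List.ofFn (digitFormula (K := K)),
      ψ.treeSize ≤ 15 + 8 * ((2 * K + 3) * (K + 2)) := by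
    rw [List.forall_mem_ofFn_iff]
    intro i
    have e₁ := treeSize_linEq_le (abs_coeffs_le h0 (hsingle i) hzero h0) h0
    have e₂ := treeSize_linEq_le (abs_coeffs_le h0 hzero (hsingle i) h0) h0
    have e₃ := treeSize_linEq_le (abs_coeffs_le h0 (hsingle i) hzero h0) hneg
    have e₄ := treeSize_linEq_le (abs_coeffs_le h0 hzero (hsingle i) hneg) h0
    rw [hcard, show 2 * K + 2 + 1 = 2 * K + 3 from rfl] at e₁ e₂ e₃ e₄
    simp only [digitFormula, treeSize]
    omega
  have hrem : (remainderFormula K).treeSize ≤ 3 + 2 * ((2 * K + 3) * (K + 2)) := by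
    have e₁ := treeSize_linGe_le (abs_coeffs_le hone hzero hpow' h0) hneg
    have e₂ := treeSize_linGe_le (abs_coeffs_le hneg hpow hpow h0) hneg
    rw [hcard, show 2 * K + 2 + 1 = 2 * K + 3 from rfl] at e₁ e₂
    rw [remainderFormula, treeSize]
    omega
  have h := treeSize_conj_le (φ := remainderFormula K) hdigit
  have hsize : (nonDivisorSpec K).size = (conj (remainderFormula K)
      (List.ofFn digitFormula)).treeSize + Fintype.card (Fin 1 ⊕ Fin (K + K + 1)) := rfl
  rw [List.length_ofFn, show 1 + (15 + 8 * ((2 * K + 3) * (K + 2))) =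
    16 + 8 * ((2 * K + 3) * (K + 2)) by omega] at h
  omega

/-- The number whose bits an output tuple holds. -/
def answer (y : Fin (K + K + 1) → ℤ) : ℤ := ∑ i : Fin K, 2 ^ (i : ℕ) * y (bitVar i)

theorem bit_eq_zero_or_one {x : Fin 1 → ℤ} {y : Fin (K + K + 1) → ℤ}
    (h : (nonDivisorSpec K).Rel x y) (i : Fin K) : y (bitVar i) = 0 ∨ y (bitVar i) = 1 :=
  ((rel_nonDivisorSpec.1 h).1 i).imp And.left And.left

theorem not_answer_dvd {x : Fin 1 → ℤ} {y : Fin (K + K + 1) → ℤ}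
    (h : (nonDivisorSpec K).Rel x y) : ¬ answer y ∣ x 0 := by
  obtain ⟨hd, h₁, h₂⟩ := rel_nonDivisorSpec.1 h
  have hmul : ∑ i : Fin K, 2 ^ (i : ℕ) * y (prodVar i) = answer y * y (Fin.last _) := by
    rw [answer, Finset.sum_mul]
    refine Finset.sum_congr rfl fun i _ => ?_
    rcases hd i with ⟨hb, hp⟩ | ⟨hb, hp⟩ <;> simp [hb, hp]
  rw [hmul] at h₁ h₂
  intro hdvd
  exact absurd (Int.le_of_dvd (by omega) (dvd_sub hdvd (dvd_mul_right _ _))) (not_le.2 h₂)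

theorem answer_pos {x : Fin 1 → ℤ} {y : Fin (K + K + 1) → ℤ}
    (h : (nonDivisorSpec K).Rel x y) : 0 < answer y := by
  obtain ⟨-, h₁, h₂⟩ := rel_nonDivisorSpec.1 h
  unfold answer
  omega

theorem sum_two_pow_lt (K : ℕ) : ∑ i : Fin K, (2 : ℤ) ^ (i : ℕ) < 2 ^ K := by
  induction K with
  | zero => simp
  | succ K ih =>
    simp only [Fin.sum_univ_castSucc, Fin.val_castSucc, Fin.val_last, pow_succ]
    omega

theorem answer_lt {x : Fin 1 → ℤ} {y : Fin (K + K + 1) → ℤ}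
    (h : (nonDivisorSpec K).Rel x y) : answer y < 2 ^ K := by
  refine lt_of_le_of_lt (Finset.sum_le_sum fun i _ => ?_) (sum_two_pow_lt K)
  rcases bit_eq_zero_or_one h i with hb | hb <;> simp [hb]

theorem exists_bits (K m : ℕ) (hm : m < 2 ^ K) :
    ∃ b : Fin K → ℤ, (∀ i, b i = 0 ∨ b i = 1) ∧ ∑ i : Fin K, 2 ^ (i : ℕ) * b i = m := by
  induction K generalizing m with
  | zero => exact ⟨fun _ => 0, fun _ => Or.inl rfl, by simp at hm ⊢; omega⟩
  | succ K ih =>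
    obtain ⟨b, hb, hs⟩ := ih (m / 2) (by rw [pow_succ] at hm; omega)
    refine ⟨Fin.cons (α := fun _ => ℤ) ((m % 2 : ℕ) : ℤ) b, fun i => ?_, ?_⟩
    · refine Fin.cases ?_ (fun i => ?_) i
      · rw [Fin.cons_zero]
        omega
      · rw [Fin.cons_succ]
        exact hb i
    · have : ∑ i : Fin K, (2 : ℤ) ^ ((i : ℕ) + 1) * b i = 2 * ((m / 2 : ℕ) : ℤ) := by
        rw [← hs, Finset.mul_sum]
        exact Finset.sum_congr rfl fun i _ => by ring
      simp only [Fin.sum_univ_succ, Fin.cons_zero, Fin.cons_succ, Fin.val_zero, Fin.val_succ,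
        pow_zero, one_mul, this]
      omega

theorem exists_rel_of_not_dvd {m : ℕ} (hm : m < 2 ^ K) (hm0 : 0 < m) {x : Fin 1 → ℤ}
    (h : ¬ (m : ℤ) ∣ x 0) : ∃ y, (nonDivisorSpec K).Rel x y := by
  obtain ⟨b, hb, hs⟩ := exists_bits K m hm
  refine ⟨Fin.snoc (α := fun _ => ℤ) (Fin.append b fun i => b i * (x 0 / m)) (x 0 / m),
    rel_nonDivisorSpec.2 ?_⟩
  simp only [bitVar, prodVar, Fin.snoc_castSucc, Fin.append_left, Fin.append_right, Fin.snoc_last,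
    ← mul_assoc, ← Finset.sum_mul, hs]
  refine ⟨fun i => ?_, ?_⟩
  · rcases hb i with h | h <;> simp [h]
  · have h₁ := Int.emod_add_mul_ediv (x 0) m
    have h₂ := Int.emod_nonneg (x 0) (b := m) (by omega)
    have h₃ := Int.emod_lt_of_pos (x 0) (b := m) (by omega)
    have h₄ : x 0 % m ≠ 0 := fun h₅ => h (Int.dvd_of_emod_eq_zero h₅)
    omega

end NonDivisor

/-! ### Common multiples -/

/-- The powers of primes that divide the central binomial coefficient `(2 * N).choose N` are at
most `2 * N`, so a common multiple of `1, …, 2 * N` is a multiple of it. -/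
theorem exists_not_dvd_of_lt_centralBinom {N X : ℕ} (hX : 0 < X) (h : X < N.centralBinom) :
    ∃ m, 0 < m ∧ m ≤ 2 * N ∧ ¬ m ∣ X := by
  by_contra! hall
  refine absurd (Nat.le_of_dvd hX ?_) (not_le.2 h)
  rw [Nat.dvd_iff_prime_pow_dvd_dvd]
  intro p k hp hk
  have hN : 0 < 2 * N := by
    rcases N.eq_zero_or_pos with rfl | hN
    · rw [Nat.centralBinom_zero] at h
      omega
    · omega
  refine hall _ (pow_pos hp.pos k) ?_
  have hle : k ≤ N.centralBinom.factorization p :=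
    (hp.pow_dvd_iff_le_factorization (Nat.centralBinom_ne_zero N)).1 hk
  refine (Nat.pow_le_pow_right hp.pos hle).trans ?_
  exact Nat.pow_factorization_choose_le hN

theorem two_pow_le_centralBinom {N : ℕ} (hN : 4 ≤ N) : 2 ^ N ≤ N.centralBinom := by
  have h := Nat.four_pow_lt_mul_centralBinom N hN
  have h4 : 4 ^ N = 2 ^ N * 2 ^ N := by norm_num [← mul_pow]
  by_contra! hlt
  have : N * N.centralBinom ≤ 2 ^ N * 2 ^ N := Nat.mul_le_mul Nat.lt_two_pow_self.le hlt.le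
  omega

/-! ### Circuits along a ray -/

/-- `h` agrees, for all large arguments, with an affine function whose slope is a multiple
of `D`. -/
def EventuallyAffine (D : ℤ) (h : ℤ → ℤ) : Prop :=
  ∃ a b : ℤ, ∀ᶠ t in atTop, h t = D * a * t + b

namespace EventuallyAffine

variable {D : ℤ} {g h : ℤ → ℤ}

theorem const (D c : ℤ) : EventuallyAffine D fun _ => c :=
  ⟨0, c, Eventually.of_forall fun t => by ring⟩

theorem add (hg : EventuallyAffine D g) (hh : EventuallyAffine D h) :
    EventuallyAffine D fun t => g t + h t := by
  obtain ⟨a, b, e⟩ := hg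
  obtain ⟨a', b', e'⟩ := hh
  refine ⟨a + a', b + b', ?_⟩
  filter_upwards [e, e'] with t ht ht'
  rw [ht, ht']
  ring

theorem const_mul (c : ℤ) (hg : EventuallyAffine D g) : EventuallyAffine D fun t => c * g t := by
  obtain ⟨a, b, e⟩ := hg
  refine ⟨c * a, c * b, ?_⟩
  filter_upwards [e] with t ht
  rw [ht]
  ring

theorem congr (hg : EventuallyAffine D g) (e : ∀ᶠ t in atTop, h t = g t) :
    EventuallyAffine D h := by
  obtain ⟨a, b, e'⟩ := hg
  refine ⟨a, b, ?_⟩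
  filter_upwards [e, e'] with t ht ht'
  rw [ht, ht']

theorem of_mul {m : ℤ} (hg : EventuallyAffine (m * D) g) : EventuallyAffine D g := by
  obtain ⟨a, b, e⟩ := hg
  refine ⟨m * a, b, ?_⟩
  filter_upwards [e] with t ht
  rw [ht]
  ring

/-- The sign of an eventually affine function is eventually constant. -/
theorem eventually_sign (hg : EventuallyAffine D g) :
    (∀ᶠ t in atTop, 0 < g t) ∨ (∀ᶠ t in atTop, g t = 0) ∨ ∀ᶠ t in atTop, g t < 0 := by
  obtain ⟨a, b, e⟩ := hg
  rcases lt_trichotomy (D * a) 0 with ha | ha | ha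
  · refine Or.inr (Or.inr ?_)
    filter_upwards [e, eventually_gt_atTop |b|] with t ht hb
    have h₁ := le_abs_self b
    have h₂ := abs_nonneg b
    rw [ht]
    nlinarith
  · simp only [ha, zero_mul, zero_add] at e
    rcases lt_trichotomy b 0 with hb | hb | hb
    · exact Or.inr (Or.inr (e.mono fun t ht => by rwa [ht]))
    · exact Or.inr (Or.inl (e.mono fun t ht => by rwa [ht]))
    · exact Or.inl (e.mono fun t ht => by rwa [ht])
  · refine Or.inl ?_
    filter_upwards [e, eventually_gt_atTop |b|] with t ht hb
    have h₁ := neg_abs_le b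
    have h₂ := abs_nonneg b
    rw [ht]
    nlinarith

theorem max (hg : EventuallyAffine D g) (hh : EventuallyAffine D h) :
    EventuallyAffine D fun t => Max.max (g t) (h t) := by
  rcases (hg.add (hh.const_mul (-1))).eventually_sign with e | e | e
  · exact hg.congr (e.mono fun t ht => max_eq_left (by linarith))
  · exact hg.congr (e.mono fun t ht => max_eq_left (by linarith))
  · exact hh.congr (e.mono fun t ht => max_eq_right (by linarith))

theorem zeroCond (hg : EventuallyAffine D g) (hh : EventuallyAffine D h) :
    EventuallyAffine D fun t => if g t = 0 then h t else 0 := by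
  rcases hg.eventually_sign with e | e | e
  · exact (const D 0).congr (e.mono fun t ht => if_neg ht.ne')
  · exact hh.congr (e.mono fun t ht => if_pos ht)
  · exact (const D 0).congr (e.mono fun t ht => if_neg ht.ne)

/-- Rounding after division by `m` preserves affinity if the slope is a multiple of `m`. -/
theorem div {m : ℤ} (hm : m ≠ 0) (hg : EventuallyAffine (m * D) g) :
    EventuallyAffine D fun t => ⌊(g t : ℚ) / (m : ℚ)⌋ := by
  obtain ⟨a, b, e⟩ := hg
  refine ⟨a, ⌊(b : ℚ) / (m : ℚ)⌋, ?_⟩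
  filter_upwards [e] with t ht
  have hm' : (m : ℚ) ≠ 0 := by exact_mod_cast hm
  have : (g t : ℚ) / m = ((D * a * t : ℤ) : ℚ) + (b : ℚ) / m := by
    rw [ht]
    push_cast
    field_simp
  rw [this, Int.floor_intCast_add]

end EventuallyAffine

namespace Gate

variable {w : ℕ}

/-- The constant by which a division gate divides, and `1` for every other gate. -/
def divisor : Gate w → ℤ
  | div m _ _ => m
  | _ => 1

theorem divisor_ne_zero (g : Gate w) : g.divisor ≠ 0 := by
  cases g <;> simp_all [divisor]

theorem natAbs_divisor_le (g : Gate w) : g.divisor.natAbs ≤ 2 ^ g.size := by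
  cases g with
  | div m hm i =>
    refine (Nat.lt_size_self m.natAbs).le.trans (Nat.pow_le_pow_right (by norm_num) ?_)
    simp only [size, intBits]
    omega
  | _ => exact Nat.one_le_two_pow

theorem eventuallyAffine_eval (g : Gate w) {D : ℤ} {v : ℤ → Fin w → ℤ}
    (hv : ∀ j, EventuallyAffine (g.divisor * D) fun t => v t j) :
    EventuallyAffine D fun t => g.eval (v t) := by
  have hv' j := (hv j).of_mul
  cases g with
  | affine b l =>
    refine (EventuallyAffine.const D b).add ?_
    induction l with
    | nil => exact EventuallyAffine.const D 0
    | cons p l ih =>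
      simp only [List.map_cons, List.sum_cons]
      exact ((hv' p.2).const_mul p.1).add (ih hv)
  | max i j => exact (hv' i).max (hv' j)
  | zeroCond i j => exact (hv' i).zeroCond (hv' j)
  | div m hm i => exact (hv i).div hm

end Gate

namespace GateSeq

variable {k : ℕ}

/-- The product of the constants of the division gates. -/
def divisor : {w : ℕ} → GateSeq k w → ℤ
  | _, inputs => 1
  | _, snoc s g => s.divisor * g.divisor

theorem divisor_ne_zero {w : ℕ} (s : GateSeq k w) : s.divisor ≠ 0 := by
  induction s with
  | inputs => exact one_ne_zero
  | snoc s g ih => exact mul_ne_zero ih g.divisor_ne_zero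

theorem natAbs_divisor_le {w : ℕ} (s : GateSeq k w) : s.divisor.natAbs ≤ 2 ^ s.size := by
  induction s with
  | inputs => exact Nat.one_le_two_pow
  | snoc s g ih =>
    rw [divisor, Int.natAbs_mul, size, pow_add]
    exact Nat.mul_le_mul ih g.natAbs_divisor_le

/-- Along the ray of the inputs `s.divisor * D * t`, all nodes are eventually affine in `t`. The
factor `D` in the slopes is what later division gates consume. -/
theorem eventuallyAffine_eval {w : ℕ} (s : GateSeq k w) (D : ℤ) (j : Fin w) :
    EventuallyAffine D fun t => s.eval (fun _ => s.divisor * D * t) j := by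
  induction s generalizing D with
  | inputs => exact ⟨1, 0, Eventually.of_forall fun t => by simp [eval, divisor]⟩
  | snoc s g ih =>
    have e (t : ℤ) : (fun _ : Fin k => (s.snoc g).divisor * D * t) =
        fun _ => s.divisor * (g.divisor * D) * t := by
      funext
      simp only [divisor]
      ring
    simp only [e, eval]
    refine Fin.lastCases ?_ (fun i => ?_) j
    · simp only [Fin.snoc_last]
      exact g.eventuallyAffine_eval fun i => ih _ i
    · simp only [Fin.snoc_castSucc]
      exact (ih _ i).of_mul

end GateSeq

/-! ### The lower bound -/

/-- An affine function that takes only the values `0` and `1` at arbitrarily large arguments is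
constant. -/
theorem EventuallyAffine.eventually_const {h : ℤ → ℤ} (hh : EventuallyAffine 1 h)
    (hf : ∃ᶠ t in atTop, h t = 0 ∨ h t = 1) : ∃ c, ∀ᶠ t in atTop, h t = c := by
  obtain ⟨a, b, e⟩ := hh
  simp only [one_mul] at e
  obtain ⟨t, ⟨ht, hb⟩, h01⟩ := ((e.and (eventually_gt_atTop (|b| + 1))).and_frequently hf).exists
  suffices a = 0 from ⟨b, e.mono fun t ht => by simpa [this] using ht⟩
  rw [ht] at h01
  have h₁ := neg_abs_le b
  have h₂ := le_abs_self b
  have h₃ := abs_nonneg b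
  rcases lt_trichotomy a 0 with ha | ha | ha
  · rcases h01 with h01 | h01 <;> nlinarith
  · exact ha
  · rcases h01 with h01 | h01 <;> nlinarith

/-- The integers congruent to `c` modulo `m` are unbounded. -/
theorem frequently_eq_add_mul {m : ℤ} (hm : 0 < m) (c : ℤ) :
    ∃ᶠ t in atTop, ∃ k, t = c + m * k := by
  rw [frequently_atTop]
  intro T
  refine ⟨c + m * (|T| + |c|), ?_, _, rfl⟩
  have h₁ := neg_abs_le c
  have h₂ := le_abs_self T
  have h₃ := abs_nonneg T
  have h₄ := abs_nonneg c
  nlinarith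

/-- If the bound failed, no multiple `P * c` with `0 < c ≤ 2 ^ K` of the product `P` of the divisors
of the circuit would be divisible by all `K`-bit numbers. This applies to `c = 1`, which shows that
the answers along the ray are eventually a constant, and then to that constant. -/
theorem centralBinom_le_of_isSkolem {K N : ℕ} (hN : 2 * N < 2 ^ K) (C : Circuit 1 (K + K + 1))
    (hC : (nonDivisorSpec K).IsSkolem C.eval) : N.centralBinom ≤ 2 ^ C.size * 2 ^ K := by
  set P := C.gates.divisor with hP
  have hP0 : P ≠ 0 := C.gates.divisor_ne_zero
  have hPle : P.natAbs ≤ 2 ^ C.size := C.gates.natAbs_divisor_le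
  by_contra! hlt
  let y : ℤ → Fin (K + K + 1) → ℤ := fun t => C.eval fun _ => P * t
  -- If `m` does not divide `P * c`, then it divides none of the inputs `P * (c + c * m * k)`, so that
  -- the specification can be met on all of them.
  have key (c : ℤ) (hc0 : 0 < c) (hc : c ≤ 2 ^ K) :
      ∃ m : ℤ, 0 < m ∧ ∀ k, (nonDivisorSpec K).Rel (fun _ => P * (c + c * m * k))
        (y (c + c * m * k)) := by
    have hcN : c.natAbs ≤ 2 ^ K := by
      zify
      rwa [abs_of_pos hc0]
    obtain ⟨m, hm0, hm, hdvd⟩ := exists_not_dvd_of_lt_centralBinom (N := N)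
      (X := (P * c).natAbs) (Int.natAbs_pos.2 (mul_ne_zero hP0 hc0.ne'))
      (by rw [Int.natAbs_mul]; exact (Nat.mul_le_mul hPle hcN).trans_lt hlt)
    refine ⟨m, by exact_mod_cast hm0, fun k => hC _ ?_⟩
    refine exists_rel_of_not_dvd (hm.trans_lt hN) hm0 fun h => hdvd ?_
    rw [← Int.natCast_dvd]
    have : P * c = P * (c + c * m * k) - m * (P * c * k) := by ring
    rw [this]
    exact dvd_sub h (dvd_mul_right _ _)
  obtain ⟨m, hm0, hm⟩ := key 1 one_pos (one_le_pow₀ (by norm_num))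
  simp only [one_mul] at hm
  have hfreq := frequently_eq_add_mul hm0 1
  have hbit (i : Fin K) : ∃ c, ∀ᶠ t in atTop, y t (bitVar i) = c := by
    refine EventuallyAffine.eventually_const ?_ (hfreq.mono ?_)
    · have := C.gates.eventuallyAffine_eval 1 (C.out (bitVar i))
      simp only [mul_one] at this
      exact this
    · rintro t ⟨k, rfl⟩
      exact bit_eq_zero_or_one (hm k) i
  choose b hb using hbit
  have hans : ∀ᶠ t in atTop, answer (y t) = ∑ i : Fin K, 2 ^ (i : ℕ) * b i :=
    (eventually_all.2 hb).mono fun t ht => Finset.sum_congr rfl fun i _ => by rw [ht i]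
  obtain ⟨-, ht, k, rfl⟩ := (hans.and_frequently hfreq).exists
  have hpos := answer_pos (hm k)
  have hle := (answer_lt (hm k)).le
  rw [ht] at hpos hle
  obtain ⟨m', hm0', hm'⟩ := key _ hpos hle
  -- Now `c` is the constant answer itself: it divides the inputs `P * (c + c * m' * k')`, and the
  -- circuit still gives it when `k'` is large.
  obtain ⟨-, ht', k', rfl⟩ :=
    (hans.and_frequently (frequently_eq_add_mul (mul_pos hpos hm0') _)).exists
  refine not_answer_dvd (hm' k') ?_
  rw [ht']
  exact (((dvd_refl _).add ((dvd_mul_right _ _).mul_right _)).mul_left _)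

theorem two_pow_le_size_of_isSkolem {n : ℕ} (hn : 3 ≤ n) (C : Circuit 1 (n + 3 + (n + 3) + 1))
    (hC : (nonDivisorSpec (n + 3)).IsSkolem C.eval) : 2 ^ n ≤ C.size := by
  -- With `N = 2 ^ (n + 1)`, the bound is `2 ^ N ≤ 2 ^ (C.size + (n + 3))`, and `n + 3 ≤ N / 2`.
  have hN : 2 * 2 ^ (n + 1) < 2 ^ (n + 3) := by
    rw [← pow_succ']
    exact Nat.pow_lt_pow_right (by norm_num) (by omega)
  have h₁ := centralBinom_le_of_isSkolem hN C hC
  have h₂ : n + 3 ≤ 2 ^ n := by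
    clear h₁ hC C hN
    induction n, hn using Nat.le_induction with
    | base => norm_num
    | succ n _ ih => rw [pow_succ]; omega
  have h₃ := two_pow_le_centralBinom (N := 2 ^ (n + 1)) (by rw [pow_succ]; omega)
  rw [← pow_add] at h₁
  have h₄ := (Nat.pow_le_pow_iff_right (by norm_num)).1 (h₃.trans h₁)
  rw [pow_succ] at h₄
  omega

end PresburgerSynthesis

theorem mainTheorem2 :
    ∃ μ : ℕ → PresburgerSynthesis.Specification,
      (∃ p : Polynomial ℕ, ∀ n : ℕ, (μ n).size ≤ p.eval n) ∧
      ∃ c : ℝ, 0 < c ∧ ∃ n₀ : ℕ, ∀ n : ℕ, n₀ ≤ n →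
        ∀ f : (Fin (μ n).inputs → ℤ) → (Fin (μ n).outputs → ℤ), (μ n).IsSkolem f →
          ∀ C : PresburgerSynthesis.Circuit (μ n).inputs (μ n).outputs, C.eval = f →
            (2 : ℝ) ^ (c * (n : ℝ)) ≤ (C.size : ℝ) := by
  refine ⟨fun n => PresburgerSynthesis.nonDivisorSpec (n + 3), ?_, 1, one_pos, 3, ?_⟩
  · let q : Polynomial ℕ := Polynomial.X + 3
    refine ⟨q * (16 + 8 * ((2 * q + 3) * (q + 2))) + (3 + 2 * ((2 * q + 3) * (q + 2))) +
      (2 * q + 2), fun n => ?_⟩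
    simpa [q] using PresburgerSynthesis.size_nonDivisorSpec_le (n + 3)
  · rintro n hn f hf C rfl
    rw [one_mul, Real.rpow_natCast]
    exact_mod_cast PresburgerSynthesis.two_pow_le_size_of_isSkolem hn C hf
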